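/- Consider two hypotheses $H_0,H_1$ with prior probabilities $\pi_0,\pi_1>0$, $\pi_0+\pi_1=1$, and let $\mathbb P_j$ denote probability under $H_j$. Nodes $a_1,a_2,\ldots$ decide sequentially between them. Node $a_k$ has a private signal $X_k$ with values in a measurable space $(S,\mathcal S)$; under $H_j$ the $X_k$ are independent and identically distributed with law $\mathbb P^X_j$. The measures $\mathbb P^X_0$ and $\mathbb P^X_1$ are mutually absolutely continuous, and the likelihood ratio $L_X=d\mathbb P^X_1/d\mathbb P^X_0$ is unbounded: $\inf_{S'}L_X=0$ and $\sup_{S'}L_X=\infty$ for every $S'\in\mathcal S$ of probability $1$ under $(\mathbb P^X_0+\mathbb P^X_1)/2$. The decision $d_k\in\{0,1\}$ of $a_k$ is broadcast through a binary erasure channel with output $\hat d_k\in\{d_k,e\}$ and erasure probabilities $\mathbb P(\hat d_k=e\mid d_k=j)$, $j=0,1$, which are the same under both hypotheses; the channels of different nodes are independent of each other and of all private signals. Node $a_k$ observes $X_k$ and the vector $\hat D_{m_k}$ of the channel outputs of its $m_k$ immediate predecessors (of all its predecessors if $m_k\ge k-1$). A decision strategy is a sequence of thresholds $t_k>0$;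 under it, $a_k$ applies the likelihood ratio test $$d_k=1\ \text{ if } L_X(X_k)\,L^k_D(\hat D_{m_k})>t_k,\qquad d_k=0\ \text{ otherwise},\qquad L^k_D(v)=\frac{\mathbb P_1(\hat D_{m_k}=v)}{\mathbb P_0(\hat D_{m_k}=v)} .$$ Suppose that $m_k\to\infty$ as $k\to\infty$ and that there is $\epsilon>0$ such that $\mathbb P(\hat d_k=e\mid d_k=j)\le 1-\epsilon$ for $j=0,1$ and all $k$. Then there exists a decision strategy such that the error probability converges to $0$: $$\lim_{k\to\infty}\bigl(\pi_0\,\mathbb P_0(d_k=1)+\pi_1\,\mathbb P_1(d_k=0)\bigr)=0 .$$ -/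

import Mathlib

open MeasureTheory ProbabilityTheory Filter Topology
open scoped ENNReal

namespace ErasureLearning

/-- Hypotheses and decisions are encoded by `Bool` (`false` is `0`, `true` is `1`).
A broadcast message is `some d` if the decision `d` gets through, and `none` if it is erased. -/
abbrev Msg : Type := Option Bool

/-- The likelihood ratio `dμ₁/dμ₀` of a private signal, where `μ j` is the law of a
signal under the hypothesis `j`. -/
noncomputable def privateLR {S : Type*} [MeasurableSpace S] (μ : Bool → Measure S) (s : S) :
    ℝ≥0∞ :=
  (μ true).rnDeriv (μ false) s

/-- The likelihood ratios of the private signals are unbounded: on every set of full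
measure for `(μ₀ + μ₁) / 2` their infimum is `0` and their supremum is `∞`. -/
def UnboundedLR {S : Type*} [MeasurableSpace S] (μ : Bool → Measure S) : Prop :=
  ∀ S' : Set S, MeasurableSet S' → ((2 : ℝ≥0∞)⁻¹ • (μ false + μ true)) S' = 1 →
    (⨅ s ∈ S', privateLR μ s) = 0 ∧ (⨆ s ∈ S', privateLR μ s) = ∞

/-- The likelihood ratio `P₁(D = v) / P₀(D = v)` of the realization `v` of a discrete
observation `D`. -/
noncomputable def obsLR {Ω V : Type*} [MeasurableSpace Ω] (P : Bool → Measure Ω)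
    (D : Ω → V) (v : V) : ℝ≥0∞ :=
  P true {ω | D ω = v} / P false {ω | D ω = v}

/-- The output of a binary erasure channel with input `d`, where `erased j` tells whether
the channel erases the input `j`. -/
def channelOut (erased : Bool → Bool) (d : Bool) : Msg :=
  if erased d then none else some d

open scoped Classical in
/-- The decision of the node `k` (nodes are numbered from `0`), with private signals `X`,
channel behaviour `E` (`E k ω j` tells whether the broadcast of node `k` is erased when its
decision is `j`), memory sizes `m` and thresholds `t`. The node observes the messages of
its `m k` immediate predecessors `k - m k, …, k - 1` (of all its predecessors if
`m k ≥ k`), and applies the likelihood ratio test with threshold `t k` to its private signal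
and these messages. -/
noncomputable def decision {Ω S : Type*} [MeasurableSpace Ω] [MeasurableSpace S]
    (P : Bool → Measure Ω) (μ : Bool → Measure S) (X : ℕ → Ω → S)
    (E : ℕ → Ω → Bool → Bool) (m : ℕ → ℕ) (t : ℕ → ℝ) (k : ℕ) : Ω → Bool :=
  let D : Ω → (Set.Ico (k - m k) k → Msg) := fun ω i =>
    channelOut (E i ω) (decision P μ X E m t i ω)
  fun ω => decide (ENNReal.ofReal (t k) < privateLR μ (X k ω) * obsLR P D (D ω))
termination_by k
decreasing_by exact i.2.2

/-- The error probability `π₀ P₀(d = 1) + π₁ P₁(d = 0)` of a decision `d`, where `p j` is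
the prior probability of the hypothesis `j`. -/
noncomputable def errorProb {Ω : Type*} [MeasurableSpace Ω]
    (P : Bool → Measure Ω) (p : Bool → ℝ) (d : Ω → Bool) : ℝ :=
  p false * (P false).real {ω | d ω = true} + p true * (P true).real {ω | d ω = false}

end ErasureLearning

/-! All nodes use the Bayes threshold `π₀ / π₁`. By the Neyman–Pearson lemma, the error probability
of a node is then at most that of every randomized test which uses the same signal and messages, so
it suffices to exhibit good tests.

Since the likelihood ratio is unbounded, a decision whose error probability is bounded away from `0`
is improved, by a fixed amount, when it is combined with one independent signal. Suppose that the
limsup of the error probabilities is `c > 0`. A late node may then read the last `n` messages, from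
the latest to the earliest, and accept a decision `j` received from node `l` with probability
`ε / (1 - q l j)`, where `q l j` is the erasure probability. In this way each decision is accepted
with probability exactly `ε`, independently of the decision itself and of all the other messages.
The first accepted decision, combined with the node's own signal, has an error probability below `c`
by a fixed amount, and nothing is accepted with probability `(1 - ε) ^ n`. For large `n` the error
probabilities are thus eventually below some `c' < c`, a contradiction. -/

namespace ErasureLearning

section RandomizedTest

variable {Ω : Type*}

/-- A randomized test of the two hypotheses which uses the information `𝓖`: having observed
`ω`, it decides for `true` with probability `φ ω`. -/
structure IsRandomizedTest (𝓖 : MeasurableSpace Ω) (φ : Ω → ℝ) : Prop where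
  measurable : Measurable[𝓖] φ
  mem_Icc : ∀ ω, φ ω ∈ Set.Icc 0 1

namespace IsRandomizedTest

lemma zero (𝓖 : MeasurableSpace Ω) : IsRandomizedTest 𝓖 fun _ => 0 :=
  ⟨measurable_const, fun _ => by simp⟩

lemma indicator_eq_true {𝓖 : MeasurableSpace Ω} {d : Ω → Bool} (hd : Measurable d) :
    IsRandomizedTest 𝓖 ({ω | d ω = true}.indicator 1) where
  measurable := measurable_one.indicator (hd (measurableSet_singleton true))
  mem_Icc ω := by by_cases h : d ω = true <;> simp [h]

lemma mono {𝓖 𝓗 : MeasurableSpace Ω} {φ : Ω → ℝ} (hφ : IsRandomizedTest 𝓖 φ) (h : 𝓖 ≤ 𝓗) :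
    IsRandomizedTest 𝓗 φ :=
  ⟨hφ.measurable.mono h le_rfl, hφ.mem_Icc⟩

lemma integrable {𝓖 mΩ : MeasurableSpace Ω} {φ : Ω → ℝ} (hφ : IsRandomizedTest 𝓖 φ)
    (h𝓖 : 𝓖 ≤ mΩ) (P : Measure Ω) [IsFiniteMeasure P] : Integrable φ P :=
  .of_mem_Icc 0 1 (hφ.measurable.mono h𝓖 le_rfl).aemeasurable (ae_of_all _ hφ.mem_Icc)

lemma exists_eq_comp {Y : Type*} [mY : MeasurableSpace Y] {Z : Ω → Y} {φ : Ω → ℝ}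
    (hφ : IsRandomizedTest (mY.comap Z) φ) : ∃ g, IsRandomizedTest mY g ∧ φ = g ∘ Z := by
  obtain ⟨g, hg, hφg⟩ := hφ.measurable.exists_eq_measurable_comp
  refine ⟨fun y => max 0 (min 1 (g y)), ⟨measurable_const.max (measurable_const.min hg),
    fun y => ⟨le_max_left _ _, max_le zero_le_one (min_le_left _ _)⟩⟩, funext fun ω => ?_⟩
  have hgω : g (Z ω) ∈ Set.Icc 0 1 := by
    simpa only [hφg, Function.comp_apply] using hφ.mem_Icc ω
  simp only [hφg, Function.comp_apply, min_eq_right hgω.2, max_eq_right hgω.1]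

end IsRandomizedTest

variable [MeasurableSpace Ω]

/-- The error probability `π₀ E₀[φ] + π₁ (1 - E₁[φ])` of a randomized test `φ`; it extends
`errorProb` to tests which need not be deterministic. -/
noncomputable def testRisk (P : Bool → Measure Ω) (p : Bool → ℝ) (φ : Ω → ℝ) : ℝ :=
  p false * ∫ ω, φ ω ∂P false + p true * (1 - ∫ ω, φ ω ∂P true)

lemma testRisk_mix (P : Bool → Measure Ω) (p : Bool → ℝ) {φ f ψ : Ω → ℝ} {ε : ℝ}
    (h : ∀ j, ∫ ω, φ ω ∂P j = ε * ∫ ω, f ω ∂P j + (1 - ε) * ∫ ω, ψ ω ∂P j) :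
    testRisk P p φ = ε * testRisk P p f + (1 - ε) * testRisk P p ψ := by
  simp only [testRisk, h]
  ring

lemma testRisk_comp {Y : Type*} [MeasurableSpace Y] (P : Bool → Measure Ω) (p : Bool → ℝ)
    {Z : Ω → Y} (hZ : Measurable Z) {φ : Y → ℝ} (hφ : Measurable φ) :
    testRisk P p (φ ∘ Z) = testRisk (fun j => (P j).map Z) p φ := by
  simp only [testRisk, Function.comp_apply,
    integral_map hZ.aemeasurable hφ.aestronglyMeasurable]

lemma errorProb_comp {Y : Type*} [MeasurableSpace Y] (P : Bool → Measure Ω) (p : Bool → ℝ)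
    {Z : Ω → Y} (hZ : Measurable Z) {d : Y → Bool} (hd : Measurable d) :
    errorProb P p (d ∘ Z) = errorProb (fun j => (P j).map Z) p d := by
  have (i j : Bool) : ((P j).map Z).real {y | d y = i} = (P j).real {ω | d (Z ω) = i} :=
    map_measureReal_apply hZ (hd (measurableSet_singleton i))
  simp only [errorProb, Function.comp_apply, this]

lemma errorProb_nonneg (P : Bool → Measure Ω) {p : Bool → ℝ} (hp : ∀ j, 0 ≤ p j)
    (d : Ω → Bool) : 0 ≤ errorProb P p d :=
  add_nonneg (mul_nonneg (hp false) measureReal_nonneg)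
    (mul_nonneg (hp true) measureReal_nonneg)

variable (P : Bool → Measure Ω) [∀ j, IsProbabilityMeasure (P j)]

lemma errorProb_le_add {p : Bool → ℝ} (hp : ∀ j, 0 ≤ p j) (d : Ω → Bool) :
    errorProb P p d ≤ p false + p true :=
  add_le_add (mul_le_of_le_one_right (hp false) measureReal_le_one)
    (mul_le_of_le_one_right (hp true) measureReal_le_one)

lemma errorProb_eq_testRisk (p : Bool → ℝ) {d : Ω → Bool} (hd : Measurable d) :
    errorProb P p d = testRisk P p ({ω | d ω = true}.indicator 1) := by
  have hm : MeasurableSet {ω | d ω = true} := hd (measurableSet_singleton true)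
  have hc : {ω | d ω = false} = {ω | d ω = true}ᶜ := by ext; simp
  rw [errorProb, testRisk, integral_indicator_one hm, integral_indicator_one hm, hc,
    probReal_compl_eq_one_sub hm]

end RandomizedTest

section LikelihoodRatioTest

lemma mul_setIntegral_withDensity_le {Y : Type*} [MeasurableSpace Y] {ν : Measure Y}
    {f g : Y → ℝ≥0∞} {a b : ℝ} (ha : 0 ≤ a) (hb : 0 ≤ b) {A : Set Y} (hA : MeasurableSet A)
    (hfg : ∀ y ∈ A, ENNReal.ofReal a * f y ≤ ENNReal.ofReal b * g y) {ψ : Y → ℝ}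
    (hψ : ∀ y, 0 ≤ ψ y) (hi : Integrable ψ (ν.withDensity g)) :
    a * ∫ y in A, ψ y ∂ν.withDensity f ≤ b * ∫ y in A, ψ y ∂ν.withDensity g := by
  have hle : (ENNReal.ofReal a • ν.withDensity f).restrict A ≤
      (ENNReal.ofReal b • ν.withDensity g).restrict A := by
    rw [← withDensity_smul' _ _ ENNReal.ofReal_ne_top,
      ← withDensity_smul' _ _ ENNReal.ofReal_ne_top, restrict_withDensity hA,
      restrict_withDensity hA]
    exact withDensity_mono (ae_restrict_of_forall_mem hA hfg)
  have := integral_mono_measure hle (ae_of_all _ hψ)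
    (hi.smul_measure ENNReal.ofReal_ne_top).restrict
  simpa only [Measure.restrict_smul, integral_smul_measure, ENNReal.toReal_ofReal ha,
    ENNReal.toReal_ofReal hb, smul_eq_mul] using this

theorem errorProb_le_testRisk_of_withDensity {Y : Type*} [mY : MeasurableSpace Y]
    {ν : Measure Y} {f : Bool → Y → ℝ≥0∞} {P : Bool → Measure Y}
    [∀ j, IsProbabilityMeasure (P j)] (hP : ∀ j, P j = ν.withDensity (f j)) {p : Bool → ℝ}
    (hp : ∀ j, 0 ≤ p j) {d : Y → Bool} (hd : Measurable d)
    (hdf : ∀ y, d y = true ↔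
      ENNReal.ofReal (p false) * f false y < ENNReal.ofReal (p true) * f true y)
    {φ : Y → ℝ} (hφ : IsRandomizedTest mY φ) :
    errorProb P p d ≤ testRisk P p φ := by
  set A := {y | d y = true}
  have hA : MeasurableSet A := hd (measurableSet_singleton true)
  have hAc : {y | d y = false} = Aᶜ := by ext; simp [A]
  have hi (j : Bool) : Integrable φ (P j) := hφ.integrable le_rfl _
  have haccept : p false * ∫ y in A, (1 - φ y) ∂P false ≤
      p true * ∫ y in A, (1 - φ y) ∂P true := by
    rw [hP, hP]
    exact mul_setIntegral_withDensity_le (hp _) (hp _) hA (fun y hy => ((hdf y).1 hy).le)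
      (fun y => sub_nonneg.2 (hφ.mem_Icc y).2)
      (hP true ▸ (integrable_const (1 : ℝ)).sub (hi true))
  have hreject : p true * ∫ y in Aᶜ, φ y ∂P true ≤ p false * ∫ y in Aᶜ, φ y ∂P false := by
    rw [hP, hP]
    exact mul_setIntegral_withDensity_le (hp _) (hp _) hA.compl
      (fun y hy => not_lt.1 (mt (hdf y).2 hy)) (fun y => (hφ.mem_Icc y).1)
      (hP false ▸ hi false)
  have hsub (j : Bool) : ∫ y in A, (1 - φ y) ∂P j = (P j).real A - ∫ y in A, φ y ∂P j := by
    rw [integral_sub (integrable_const _) (hi j).integrableOn, setIntegral_const, smul_eq_mul,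
      mul_one]
  rw [hsub, hsub] at haccept
  rw [errorProb, testRisk, hAc, probReal_compl_eq_one_sub hA,
    ← integral_add_compl hA (hi false), ← integral_add_compl hA (hi true)]
  linarith

lemma ofReal_div_lt_mul_div_iff {a b : ℝ} (ha : 0 < a) (x y : ℝ≥0∞) {z : ℝ≥0∞}
    (hz : z ≠ ∞) : ENNReal.ofReal (b / a) < x * (y / z) ↔
      ENNReal.ofReal b * z < ENNReal.ofReal a * (x * y) := by
  rw [ENNReal.ofReal_div_of_pos ha, ENNReal.div_lt_iff (by simp [ha]) (by simp),
    show x * (y / z) * ENNReal.ofReal a = ENNReal.ofReal a * (x * y) / z by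
      simp only [div_eq_mul_inv]; ring,
    ENNReal.lt_div_iff_mul_lt (by simp) (by simp [hz])]

lemma withDensity_privateLR {S : Type*} [MeasurableSpace S] {μ : Bool → Measure S}
    [∀ j, SigmaFinite (μ j)] (hμ : μ true ≪ μ false) (j : Bool) :
    μ j = (μ false).withDensity (fun s => bif j then privateLR μ s else 1) := by
  cases j
  · exact withDensity_one.symm
  · exact (Measure.withDensity_rnDeriv_eq _ _ hμ).symm

lemma eq_count_withDensity {V : Type*} [MeasurableSpace V] [Countable V]
    [MeasurableSingletonClass V] (ρ : Measure V) :
    ρ = Measure.count.withDensity fun v => ρ {v} :=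
  Measure.ext_of_singleton fun v => by simp [withDensity_apply]

lemma measurable_privateLR {S : Type*} [MeasurableSpace S] (μ : Bool → Measure S) :
    Measurable (privateLR μ) :=
  Measure.measurable_rnDeriv _ _

lemma measurable_likelihoodRatioTest {T S V : Type*} {𝓖 : MeasurableSpace T} [MeasurableSpace S]
    [MeasurableSpace V] [DiscreteMeasurableSpace V] {μ : Bool → Measure S} {X : T → S} {D : T → V}
    (hX : Measurable[𝓖] X) (hD : Measurable[𝓖] D) {c : ℝ≥0∞} {ℓ : V → ℝ≥0∞} {d : T → Bool}
    (hd : ∀ x, d x = true ↔ c < privateLR μ (X x) * ℓ (D x)) : Measurable[𝓖] d := by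
  refine measurable_to_bool ?_
  rw [show d ⁻¹' {true} = {x | c < privateLR μ (X x) * ℓ (D x)} from Set.ext hd]
  exact measurableSet_lt measurable_const
    (((measurable_privateLR μ).comp hX).mul (Measurable.of_discrete.comp hD))

variable {Ω S V : Type*} [MeasurableSpace Ω] [MeasurableSpace S] [MeasurableSpace V]
  [Countable V] [MeasurableSingletonClass V] {P : Bool → Measure Ω}
  [∀ j, IsProbabilityMeasure (P j)] {μ : Bool → Measure S} [∀ j, IsProbabilityMeasure (μ j)]
  {X : Ω → S} {D : Ω → V}

lemma map_signal_obs_eq_withDensity (hμ : μ true ≪ μ false) (hX : Measurable X)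
    (hD : Measurable D) {j : Bool} (hXlaw : (P j).map X = μ j) (hXD : IndepFun X D (P j)) :
    (P j).map (fun ω => (X ω, D ω)) = ((μ false).prod Measure.count).withDensity fun y =>
      (bif j then privateLR μ y.1 else 1) * P j {ω | D ω = y.2} := by
  have hρ : (P j).map D = Measure.count.withDensity fun v => P j {ω | D ω = v} := by
    conv_lhs => rw [eq_count_withDensity ((P j).map D)]
    exact congrArg _ (funext fun v => Measure.map_apply hD (measurableSet_singleton v))
  rw [(indepFun_iff_map_prod_eq_prod_map_map hX.aemeasurable hD.aemeasurable).1 hXD, hXlaw, hρ,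
    withDensity_privateLR hμ j, prod_withDensity _ .of_discrete]
  cases j
  · exact measurable_const
  · exact measurable_privateLR μ

theorem errorProb_le_testRisk_of_likelihoodRatioTest (hμ : μ true ≪ μ false) {p : Bool → ℝ}
    (hp : ∀ j, 0 < p j) (hX : Measurable X) (hD : Measurable D)
    (hXlaw : ∀ j, (P j).map X = μ j) (hXD : ∀ j, IndepFun X D (P j)) {d : Ω → Bool}
    (hd : ∀ ω, d ω = true ↔
      ENNReal.ofReal (p false / p true) < privateLR μ (X ω) * obsLR P D (D ω))
    {φ : Ω → ℝ}
    (hφ : IsRandomizedTest (MeasurableSpace.comap (fun ω => (X ω, D ω)) inferInstance) φ) :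
    errorProb P p d ≤ testRisk P p φ := by
  classical
  obtain ⟨g, hg, rfl⟩ := hφ.exists_eq_comp
  set d' : S × V → Bool := fun y =>
    decide (ENNReal.ofReal (p false / p true) < privateLR μ y.1 * obsLR P D y.2)
  have hZ : Measurable fun ω => (X ω, D ω) := hX.prodMk hD
  have hd' : Measurable d' :=
    measurable_likelihoodRatioTest measurable_fst measurable_snd fun _ => decide_eq_true_iff
  have hdd' : d = d' ∘ fun ω => (X ω, D ω) :=
    funext fun ω => Bool.eq_iff_iff.2 ((hd ω).trans (by simp [d']))
  have (j : Bool) : IsProbabilityMeasure ((P j).map fun ω => (X ω, D ω)) :=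
    Measure.isProbabilityMeasure_map hZ.aemeasurable
  rw [hdd', errorProb_comp P p hZ hd', testRisk_comp P p hZ hg.measurable]
  refine errorProb_le_testRisk_of_withDensity
    (fun j => map_signal_obs_eq_withDensity hμ hX hD (hXlaw j) (hXD j)) (fun j => (hp j).le) hd'
    (fun y => decide_eq_true_iff.trans ?_) hg
  simpa [obsLR] using ofReal_div_lt_mul_div_iff (hp true) (privateLR μ y.1)
    (P true {ω | D ω = y.2}) (measure_ne_top (P false) {ω | D ω = y.2})

end LikelihoodRatioTest

section UnboundedLR

variable {S : Type*} [MeasurableSpace S] {μ : Bool → Measure S}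
  [∀ j, IsProbabilityMeasure (μ j)]

lemma half_smul_add_compl_eq_one {A : Set S} (hA : MeasurableSet A) (h : ∀ j, (μ j).real A = 0) :
    ((2 : ℝ≥0∞)⁻¹ • (μ false + μ true)) Aᶜ = 1 := by
  have hAc (j : Bool) : μ j Aᶜ = 1 :=
    (prob_compl_eq_one_iff hA).2 ((measureReal_eq_zero_iff).1 (h j))
  rw [Measure.smul_apply, Measure.add_apply, hAc, hAc, smul_eq_mul, one_add_one_eq_two,
    ENNReal.inv_mul_cancel two_ne_zero ENNReal.ofNat_ne_top]

lemma UnboundedLR.exists_measureReal_false_le (hμ : UnboundedLR μ) (hμ₁₀ : μ true ≪ μ false)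
    {δ : ℝ} (hδ : 0 < δ) : ∃ A, MeasurableSet A ∧ 0 < (μ true).real A ∧
      (μ false).real A ≤ δ * (μ true).real A := by
  set A := {s | ENNReal.ofReal δ⁻¹ < privateLR μ s}
  have hA : MeasurableSet A := measurableSet_lt measurable_const (measurable_privateLR μ)
  have hle : δ⁻¹ * (μ false).real A ≤ (μ true).real A := by
    have : ENNReal.ofReal δ⁻¹ * μ false A ≤ μ true A := by
      rw [← Measure.setLIntegral_rnDeriv' hμ₁₀ hA, ← setLIntegral_const]
      exact setLIntegral_mono' hA fun s hs => hs.le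
    simpa [measureReal_def, hδ.le] using ENNReal.toReal_mono (measure_ne_top _ _) this
  rw [inv_mul_le_iff₀ hδ] at hle
  refine ⟨A, hA, measureReal_nonneg.lt_of_ne' fun h1 => ?_, hle⟩
  have h0 : (μ false).real A = 0 :=
    le_antisymm (by simpa only [h1, mul_zero] using hle) measureReal_nonneg
  have hsup := (hμ Aᶜ hA.compl (half_smul_add_compl_eq_one hA
    (Bool.forall_bool.2 ⟨h0, h1⟩))).2
  have hle : ⨆ s ∈ Aᶜ, privateLR μ s ≤ ENNReal.ofReal δ⁻¹ := iSup₂_le fun s hs => not_lt.1 hs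
  exact ENNReal.ofReal_lt_top.not_ge (hsup.ge.trans hle)

lemma UnboundedLR.exists_measureReal_true_le (hμ : UnboundedLR μ) (hμ₁₀ : μ true ≪ μ false)
    {δ : ℝ} (hδ : 0 < δ) : ∃ B, MeasurableSet B ∧ 0 < (μ false).real B ∧
      (μ true).real B ≤ δ * (μ false).real B := by
  set B := {s | privateLR μ s < ENNReal.ofReal δ}
  have hB : MeasurableSet B := measurableSet_lt (measurable_privateLR μ) measurable_const
  have hle : (μ true).real B ≤ δ * (μ false).real B := by
    have : μ true B ≤ ENNReal.ofReal δ * μ false B := by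
      rw [← Measure.setLIntegral_rnDeriv' hμ₁₀ hB, ← setLIntegral_const]
      exact setLIntegral_mono' hB fun s hs => hs.le
    simpa [measureReal_def, hδ.le] using
      ENNReal.toReal_mono (ENNReal.mul_ne_top (by simp) (measure_ne_top _ _)) this
  refine ⟨B, hB, measureReal_nonneg.lt_of_ne' fun h0 => ?_, hle⟩
  have h1 : (μ true).real B = 0 :=
    le_antisymm (by simpa only [h0, mul_zero] using hle) measureReal_nonneg
  have hinf := (hμ Bᶜ hB.compl (half_smul_add_compl_eq_one hB
    (Bool.forall_bool.2 ⟨h0, h1⟩))).1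
  have hge : ENNReal.ofReal δ ≤ ⨅ s ∈ Bᶜ, privateLR μ s := le_iInf₂ fun s hs => not_lt.1 hs
  exact (ENNReal.ofReal_pos.2 hδ).not_ge (hge.trans hinf.le)

end UnboundedLR

section Combination

variable {Ω S : Type*} [MeasurableSpace Ω] [MeasurableSpace S] {d : Ω → Bool} {X : Ω → S}

lemma measurable_decide_mem {A : Set S} [DecidablePred (· ∈ A)] (hA : MeasurableSet A) :
    Measurable fun s => decide (s ∈ A) :=
  measurable_to_bool (by simpa [Set.preimage] using hA)

lemma measureReal_eq_or_mem_le (P : Measure Ω) (hX : Measurable X) {A : Set S}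
    (hA : MeasurableSet A) (i : Bool) :
    P.real {ω | d ω = i ∨ X ω ∈ A} ≤ P.real {ω | d ω = i} + (P.map X).real A := by
  rw [map_measureReal_apply hX hA]
  exact measureReal_union_le _ _

lemma measureReal_eq_and_mem {P : Measure Ω} (hX : Measurable X) (hdX : IndepFun d X P)
    {A : Set S} (hA : MeasurableSet A) (i : Bool) :
    P.real {ω | d ω = i ∧ X ω ∈ A} = P.real {ω | d ω = i} * (P.map X).real A := by
  rw [map_measureReal_apply hX hA, measureReal_def, measureReal_def, measureReal_def,
    ← ENNReal.toReal_mul]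
  exact congrArg ENNReal.toReal
    (hdX.measure_inter_preimage_eq_mul {i} A (measurableSet_singleton i) hA)

variable {P : Bool → Measure Ω} {μ : Bool → Measure S} [∀ j, IsProbabilityMeasure (μ j)]
  {p : Bool → ℝ}

lemma errorProb_or_le (hp : ∀ j, 0 ≤ p j) (hX : Measurable X)
    (hXlaw : ∀ j, (P j).map X = μ j) (hdX : ∀ j, IndepFun d X (P j)) {A : Set S}
    [DecidablePred (· ∈ A)] (hA : MeasurableSet A) :
    errorProb P p (fun ω => d ω || decide (X ω ∈ A)) ≤ errorProb P p d +
      p false * (μ false).real A - p true * (P true).real {ω | d ω = false} * (μ true).real A := by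
  have hmiss := measureReal_eq_and_mem hX (hdX true) hA.compl false
  rw [hXlaw, probReal_compl_eq_one_sub hA] at hmiss
  have hfalse := mul_le_mul_of_nonneg_left
    (measureReal_eq_or_mem_le (d := d) (P false) hX hA true) (hp false)
  rw [hXlaw] at hfalse
  simp only [errorProb, Bool.or_eq_true, Bool.or_eq_false_iff, decide_eq_true_iff,
    decide_eq_false_iff_not, ← Set.mem_compl_iff, hmiss]
  linarith

lemma errorProb_and_not_le (hp : ∀ j, 0 ≤ p j) (hX : Measurable X)
    (hXlaw : ∀ j, (P j).map X = μ j) (hdX : ∀ j, IndepFun d X (P j)) {B : Set S}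
    [DecidablePred (· ∈ B)] (hB : MeasurableSet B) :
    errorProb P p (fun ω => d ω && !decide (X ω ∈ B)) ≤ errorProb P p d +
      p true * (μ true).real B - p false * (P false).real {ω | d ω = true} * (μ false).real B := by
  have hfalse := measureReal_eq_and_mem hX (hdX false) hB.compl true
  rw [hXlaw, probReal_compl_eq_one_sub hB] at hfalse
  have hmiss := mul_le_mul_of_nonneg_left
    (measureReal_eq_or_mem_le (d := d) (P true) hX hB false) (hp true)
  rw [hXlaw] at hmiss
  simp only [errorProb, Bool.and_eq_true, Bool.and_eq_false_iff, Bool.not_eq_true',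
    Bool.not_eq_false', decide_eq_true_iff, decide_eq_false_iff_not, ← Set.mem_compl_iff, hfalse]
  linarith

theorem exists_rule_errorProb_le (hμ : UnboundedLR μ) (hμ₁₀ : μ true ≪ μ false)
    (hp : ∀ j, 0 < p j) {c : ℝ} (hc : 0 < c) :
    ∃ γ > 0, ∀ (X : Ω → S) (d : Ω → Bool), Measurable X →
      (∀ j, (P j).map X = μ j) → (∀ j, IndepFun d X (P j)) →
      ∃ b : Bool → S → Bool, (∀ j, Measurable (b j)) ∧
        errorProb P p (fun ω => b (d ω) (X ω)) ≤ max c (errorProb P p d - γ) := by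
  classical
  obtain ⟨A, hA, hA1, hA0⟩ := hμ.exists_measureReal_false_le hμ₁₀ (δ := c / (4 * p false))
    (div_pos hc (mul_pos four_pos (hp false)))
  obtain ⟨B, hB, hB0, hB1⟩ := hμ.exists_measureReal_true_le hμ₁₀ (δ := c / (4 * p true))
    (div_pos hc (mul_pos four_pos (hp true)))
  have hA0' : p false * (μ false).real A ≤ c / 4 * (μ true).real A := by
    calc _ ≤ p false * (c / (4 * p false) * (μ true).real A) := by gcongr; exact (hp false).le
      _ = _ := by have := (hp false).ne'; field_simp
  have hB1' : p true * (μ true).real B ≤ c / 4 * (μ false).real B := by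
    calc _ ≤ p true * (c / (4 * p true) * (μ false).real B) := by gcongr; exact (hp true).le
      _ = _ := by have := (hp true).ne'; field_simp
  refine ⟨c / 4 * min ((μ true).real A) ((μ false).real B), by positivity,
    fun X d hX hXlaw hdX => ?_⟩
  rcases le_or_gt (errorProb P p d) c with hsmall | hlarge
  · exact ⟨fun j _ => j, fun _ => measurable_const, le_max_of_le_left hsmall⟩
  rcases le_or_gt (c / 2) (p true * (P true).real {ω | d ω = false}) with hmiss | hmiss
  · refine ⟨fun j s => j || decide (s ∈ A), fun j => ?_, le_max_of_le_right ?_⟩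
    · exact (Measurable.of_discrete (f := (j || ·))).comp (measurable_decide_mem hA)
    have := errorProb_or_le (fun j => (hp j).le) hX hXlaw hdX hA
    have := mul_le_mul_of_nonneg_right hmiss hA1.le
    have := mul_le_mul_of_nonneg_left (min_le_left ((μ true).real A) ((μ false).real B))
      (div_pos hc four_pos).le
    linarith
  · have hfalse : c / 2 ≤ p false * (P false).real {ω | d ω = true} := by
      rw [errorProb] at hlarge
      linarith
    refine ⟨fun j s => j && !decide (s ∈ B), fun j => ?_, le_max_of_le_right ?_⟩
    · exact (Measurable.of_discrete (f := fun i => j && !i)).comp (measurable_decide_mem hB)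
    have := errorProb_and_not_le (fun j => (hp j).le) hX hXlaw hdX hB
    have := mul_le_mul_of_nonneg_right hfalse hB0.le
    have := mul_le_mul_of_nonneg_left (min_le_right ((μ true).real A) ((μ false).real B))
      (div_pos hc four_pos).le
    linarith

end Combination

section Independence

variable {Ω : Type*} {mΩ : MeasurableSpace Ω} {P : Measure Ω}

lemma indepFun_compl_of_iIndepFun {ι β : Type*} [MeasurableSpace β] {Z : ι → Ω → β}
    (hZ : ∀ i, Measurable (Z i)) (hindep : iIndepFun Z P) (k : ι) :
    IndepFun (Z k) (fun ω (i : ({k}ᶜ : Set ι)) => Z i ω) P := by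
  have := indep_iSup_of_disjoint (fun i => (hZ i).comap_le) hindep
    (S := {k}) (T := {k}ᶜ) disjoint_compl_right
  rw [IndepFun_iff_Indep, MeasurableSpace.pi, MeasurableSpace.comap_iSup]
  simpa only [MeasurableSpace.comap_comp, Function.comp_def, Set.mem_singleton_iff,
    iSup_iSup_eq_left, iSup_subtype'] using this

variable [IsProbabilityMeasure P]

lemma indepFun_prodMk_right {α β γ : Type*} [MeasurableSpace α] [MeasurableSpace β]
    [MeasurableSpace γ] {X : Ω → α} {Y : Ω → β} {Z : Ω → γ} (hX : Measurable X)
    (hY : Measurable Y) (hZ : Measurable Z) (hXY : IndepFun X Y P)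
    (hXYZ : IndepFun (fun ω => (X ω, Y ω)) Z P) : IndepFun Y (fun ω => (X ω, Z ω)) P := by
  have (W : Ω → α) (h : Measurable W) : IsProbabilityMeasure (P.map W) :=
    Measure.isProbabilityMeasure_map h.aemeasurable
  have hXZ : IndepFun X Z P := hXYZ.comp measurable_fst measurable_id
  have hYX : P.map (fun ω => (Y ω, X ω)) = (P.map Y).prod (P.map X) :=
    (indepFun_iff_map_prod_eq_prod_map_map hY.aemeasurable hX.aemeasurable).1 hXY.symm
  have hYXZ : P.map (fun ω => ((Y ω, X ω), Z ω)) =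
      (P.map fun ω => (Y ω, X ω)).prod (P.map Z) :=
    (indepFun_iff_map_prod_eq_prod_map_map (hY.prodMk hX).aemeasurable hZ.aemeasurable).1
      (hXYZ.comp measurable_swap measurable_id)
  refine (indepFun_iff_map_prod_eq_prod_map_map hY.aemeasurable (hX.prodMk hZ).aemeasurable).2 ?_
  rw [(indepFun_iff_map_prod_eq_prod_map_map hX.aemeasurable hZ.aemeasurable).1 hXZ,
    ← Measure.prodAssoc_prod, ← hYX, ← hYXZ,
    Measure.map_map MeasurableEquiv.prodAssoc.measurable ((hY.prodMk hX).prodMk hZ)]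
  rfl

lemma setIntegral_eq_mul_integral_of_indep {𝓖 𝓗 : MeasurableSpace Ω} (h𝓖 : 𝓖 ≤ mΩ)
    (h𝓗 : 𝓗 ≤ mΩ) (hindep : Indep 𝓖 𝓗 P) {A : Set Ω} (hA : MeasurableSet[𝓖] A) {F : Ω → ℝ}
    (hF : Measurable[𝓗] F) (hFi : Integrable F P) :
    ∫ ω in A, F ω ∂P = P.real A * ∫ ω, F ω ∂P := by
  rw [← setIntegral_condExp h𝓖 hFi hA, setIntegral_congr_ae (g := fun _ => ∫ ω, F ω ∂P)
    (h𝓖 _ hA) ((condExp_indep_eq h𝓗 h𝓖 hF.stronglyMeasurable hindep.symm).mono fun _ h _ => h),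
    setIntegral_const, smul_eq_mul]

end Independence

section AcceptElse

variable {Ω : Type*}

instance : MeasurableSpace Msg := ⊤

instance : DiscreteMeasurableSpace Msg := ⟨fun _ => trivial⟩

/-- The randomized test which reads the message `v`, accepts a received decision `j` with
probability `a j`, applies the test `g j` if it has accepted `j`, and applies the test `ψ` if the
message is erased or not accepted. -/
def acceptElse (a : Bool → ℝ) (g : Bool → Ω → ℝ) (ψ : Ω → ℝ) (v : Ω → Msg) (ω : Ω) : ℝ :=
  (v ω).elim (ψ ω) fun j => a j * g j ω + (1 - a j) * ψ ω

lemma IsRandomizedTest.acceptElse {𝓖 : MeasurableSpace Ω} {a : Bool → ℝ} {g : Bool → Ω → ℝ}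
    {ψ : Ω → ℝ} {v : Ω → Msg} (ha : ∀ j, a j ∈ Set.Icc 0 1) (hg : ∀ j, IsRandomizedTest 𝓖 (g j))
    (hψ : IsRandomizedTest 𝓖 ψ) (hv : Measurable v) :
    IsRandomizedTest 𝓖 (acceptElse a g ψ v) where
  measurable := by
    have h : Measurable fun z : Msg × Ω => z.1.elim (ψ z.2) fun j =>
        a j * g j z.2 + (1 - a j) * ψ z.2 :=
      measurable_from_prod_countable_right fun w => by
        cases w with
        | none => exact hψ.measurable
        | some j => exact ((hg j).measurable.const_mul _).add (hψ.measurable.const_mul _)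
    exact h.comp (hv.prodMk measurable_id)
  mem_Icc ω := by
    rw [ErasureLearning.acceptElse]
    cases v ω with
    | none => exact hψ.mem_Icc ω
    | some j =>
      exact convex_Icc (0 : ℝ) 1 ((hg j).mem_Icc ω) (hψ.mem_Icc ω) (ha j).1
        (sub_nonneg.2 (ha j).2) (add_sub_cancel _ _)

lemma acceptElse_channelOut (a : Bool → ℝ) (g : Bool → Ω → ℝ) (ψ : Ω → ℝ)
    (e : Ω → Bool → Bool) (d : Ω → Bool) (ω : Ω) :
    acceptElse a g ψ (fun ω => channelOut (e ω) (d ω)) ω = ψ ω + ∑ j, a j *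
      {ω | e ω j = false}.indicator ({ω | d ω = j}.indicator fun ω => g j ω - ψ ω) ω := by
  cases hd : d ω <;> cases he : e ω (d ω) <;>
    simp_all [acceptElse, channelOut, Set.indicator_apply] <;> ring

theorem integral_acceptElse {𝓗 mΩ : MeasurableSpace Ω} {P : Measure Ω} [IsProbabilityMeasure P]
    (h𝓗 : 𝓗 ≤ mΩ) {e : Ω → Bool → Bool} (he : Measurable e)
    (hindep : Indep (MeasurableSpace.comap e inferInstance) 𝓗 P) {d : Ω → Bool}
    (hd : Measurable[𝓗] d) {a : Bool → ℝ} {ε : ℝ}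
    (ha : ∀ j, a j * P.real {ω | e ω j = false} = ε) {g : Bool → Ω → ℝ} {ψ : Ω → ℝ}
    (hg : ∀ j, IsRandomizedTest 𝓗 (g j)) (hψ : IsRandomizedTest 𝓗 ψ) :
    ∫ ω, acceptElse a g ψ (fun ω => channelOut (e ω) (d ω)) ω ∂P =
      ε * ∫ ω, g (d ω) ω ∂P + (1 - ε) * ∫ ω, ψ ω ∂P := by
  have hψi := hψ.integrable h𝓗 P
  set F : Bool → Ω → ℝ := fun j => {ω | d ω = j}.indicator fun ω => g j ω - ψ ω
  have hF (j : Bool) : Measurable[𝓗] (F j) :=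
    ((hg j).measurable.sub hψ.measurable).indicator (hd (measurableSet_singleton j))
  have hFi (j : Bool) : Integrable (F j) P :=
    (((hg j).integrable h𝓗 P).sub hψi).indicator (h𝓗 _ (hd (measurableSet_singleton j)))
  have hA (j : Bool) :
      MeasurableSet[MeasurableSpace.comap e inferInstance] {ω | e ω j = false} :=
    ((measurable_pi_apply j).comp (comap_measurable e)) (measurableSet_singleton false)
  have hAm (j : Bool) : MeasurableSet {ω | e ω j = false} := he.comap_le _ (hA j)
  have hterm (j : Bool) : a j * ∫ ω, {ω | e ω j = false}.indicator (F j) ω ∂P =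
      ε * ∫ ω, F j ω ∂P := by
    rw [integral_indicator (hAm j), ← ha j, mul_assoc,
      setIntegral_eq_mul_integral_of_indep he.comap_le h𝓗 hindep (hA j) (hF j) (hFi j)]
  have hgd (ω : Ω) : g (d ω) ω = ψ ω + ∑ j, F j ω := by
    cases h : d ω <;> simp [F, h]
  simp only [acceptElse_channelOut, hgd]
  rw [integral_add hψi (integrable_finsetSum _ fun j _ => ((hFi j).indicator (hAm j)).const_mul _),
    integral_finsetSum _ fun j _ => ((hFi j).indicator (hAm j)).const_mul _,
    integral_add hψi (integrable_finsetSum _ fun j _ => hFi j),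
    integral_finsetSum _ fun j _ => hFi j]
  simp only [integral_const_mul, hterm, ← Finset.mul_sum]
  ring

end AcceptElse

section Network

variable {Ω S : Type*} [MeasurableSpace S]

/-- Under one hypothesis, with probability measure `P`: the private signals `X k` have law `ν`,
the channel of node `k` erases the decision `j` with probability `q k j`, and all the signals and
channels are independent. -/
structure IsErasureNetwork [MeasurableSpace Ω] (P : Measure Ω) (ν : Measure S)
    (q : ℕ → Bool → ℝ) (X : ℕ → Ω → S) (E : ℕ → Ω → Bool → Bool) : Prop where
  measurable_signal : ∀ k, Measurable (X k)
  measurable_channel : ∀ k, Measurable (E k)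
  map_signal : ∀ k, P.map (X k) = ν
  measureReal_erased : ∀ k j, P.real {ω | E k ω j = true} = q k j
  indepFun_signal_channel : ∀ k, IndepFun (X k) (E k) P
  iIndepFun_node : iIndepFun (fun k ω => (X k ω, E k ω)) P

/-- The information carried by the signals and channels of all nodes but `k`. -/
abbrev allButNode (X : ℕ → Ω → S) (E : ℕ → Ω → Bool → Bool) (k : ℕ) : MeasurableSpace Ω :=
  MeasurableSpace.comap (fun ω (i : ({k}ᶜ : Set ℕ)) => (X i ω, E i ω)) inferInstance

/-- The information carried by all signals, and by the channels of all nodes but `l`. -/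
abbrev allButChannel (X : ℕ → Ω → S) (E : ℕ → Ω → Bool → Bool) (l : ℕ) : MeasurableSpace Ω :=
  MeasurableSpace.comap (fun ω => (X l ω, fun i : ({l}ᶜ : Set ℕ) => (X i ω, E i ω))) inferInstance

variable {X : ℕ → Ω → S} {E : ℕ → Ω → Bool → Bool} {i k l : ℕ}

lemma measurable_node_allButNode (h : i ≠ k) :
    Measurable[allButNode X E k] fun ω => (X i ω, E i ω) :=
  (measurable_pi_apply (⟨i, h⟩ : ({k}ᶜ : Set ℕ))).comp
    (comap_measurable fun ω (i : ({k}ᶜ : Set ℕ)) => (X i ω, E i ω))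

lemma allButNode_le_allButChannel : allButNode X E l ≤ allButChannel X E l :=
  (measurable_snd.comp (comap_measurable fun ω =>
    (X l ω, fun i : ({l}ᶜ : Set ℕ) => (X i ω, E i ω)))).comap_le

lemma measurable_signal_allButChannel (i l : ℕ) : Measurable[allButChannel X E l] (X i) := by
  rcases eq_or_ne i l with rfl | h
  · exact measurable_fst.comp (comap_measurable _)
  · exact (measurable_fst.comp (measurable_node_allButNode h)).mono
      allButNode_le_allButChannel le_rfl

lemma measurable_channel_allButChannel (h : i ≠ l) : Measurable[allButChannel X E l] (E i) :=
  (measurable_snd.comp (measurable_node_allButNode h)).mono allButNode_le_allButChannel le_rfl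

namespace IsErasureNetwork

variable [MeasurableSpace Ω] {P : Measure Ω} {ν : Measure S} {q : ℕ → Bool → ℝ}

lemma measurable_node (hN : IsErasureNetwork P ν q X E) (k : ℕ) :
    Measurable fun ω => (X k ω, E k ω) :=
  (hN.measurable_signal k).prodMk (hN.measurable_channel k)

lemma allButChannel_le (hN : IsErasureNetwork P ν q X E) (l : ℕ) :
    allButChannel X E l ≤ ‹MeasurableSpace Ω› :=
  ((hN.measurable_signal l).prodMk
    (measurable_pi_lambda (fun ω (i : ({l}ᶜ : Set ℕ)) => (X i ω, E i ω)) fun i =>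
      hN.measurable_node i)).comap_le

lemma indepFun_signal_of_measurable_allButNode (hN : IsErasureNetwork P ν q X E) {V : Type*}
    [MeasurableSpace V] {D : Ω → V} (hD : Measurable[allButNode X E k] D) :
    IndepFun (X k) D P :=
  indep_of_indep_of_le_right ((indepFun_compl_of_iIndepFun hN.measurable_node
    hN.iIndepFun_node k).comp measurable_fst measurable_id) hD.comap_le

variable [IsProbabilityMeasure P]

lemma indep_channel_allButChannel (hN : IsErasureNetwork P ν q X E) (l : ℕ) :
    Indep (MeasurableSpace.comap (E l) inferInstance) (allButChannel X E l) P :=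
  indepFun_prodMk_right (hN.measurable_signal l) (hN.measurable_channel l)
    (measurable_pi_lambda _ fun i => hN.measurable_node i) (hN.indepFun_signal_channel l)
    (indepFun_compl_of_iIndepFun hN.measurable_node hN.iIndepFun_node l)

lemma measureReal_not_erased (hN : IsErasureNetwork P ν q X E) (k : ℕ) (j : Bool) :
    P.real {ω | E k ω j = false} = 1 - q k j := by
  have hm : MeasurableSet {ω | E k ω j = true} :=
    ((measurable_pi_apply j).comp (hN.measurable_channel k)) (measurableSet_singleton true)
  rw [← hN.measureReal_erased, ← probReal_compl_eq_one_sub hm]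
  congr 1
  ext
  simp

end IsErasureNetwork

/-- The decisions `d k` may depend on the signals of the nodes up to `k` and on the channels of
the nodes before `k`, and on nothing else. -/
def Nonanticipating (X : ℕ → Ω → S) (E : ℕ → Ω → Bool → Bool) (d : ℕ → Ω → Bool) : Prop :=
  ∀ (k : ℕ) (𝓖 : MeasurableSpace Ω), (∀ i ≤ k, Measurable[𝓖] (X i)) →
    (∀ i < k, Measurable[𝓖] (E i)) → Measurable[𝓖] (d k)

namespace Nonanticipating

variable {d : ℕ → Ω → Bool}

lemma measurable_allButNode (hd : Nonanticipating X E d) (h : i < k) :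
    Measurable[allButNode X E k] (d i) :=
  hd i _ (fun _ hj => measurable_fst.comp (measurable_node_allButNode (hj.trans_lt h).ne))
    fun _ hj => measurable_snd.comp (measurable_node_allButNode (hj.trans h).ne)

lemma measurable_allButChannel (hd : Nonanticipating X E d) (h : i ≤ l) :
    Measurable[allButChannel X E l] (d i) :=
  hd i _ (fun j _ => measurable_signal_allButChannel j l)
    fun _ hj => measurable_channel_allButChannel (hj.trans_le h).ne

end Nonanticipating

/-- The messages broadcast by nodes whose decisions are `d`, through channels `E`. -/
def messages (E : ℕ → Ω → Bool → Bool) (d : ℕ → Ω → Bool) (k : ℕ) (ω : Ω) : Msg :=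
  channelOut (E k ω) (d k ω)

lemma measurable_messages {𝓖 : MeasurableSpace Ω} {d : ℕ → Ω → Bool}
    (hE : Measurable[𝓖] (E k)) (hd : Measurable[𝓖] (d k)) : Measurable[𝓖] (messages E d k) :=
  (Measurable.of_discrete (f := fun x : (Bool → Bool) × Bool => channelOut x.1 x.2)).comp
    (hE.prodMk hd)

lemma measurable_messages_restrict {𝓖 : MeasurableSpace Ω} {d : ℕ → Ω → Bool} {I : Set ℕ}
    (hE : ∀ i ∈ I, Measurable[𝓖] (E i)) (hd : ∀ i ∈ I, Measurable[𝓖] (d i)) :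
    Measurable[𝓖] fun ω (i : I) => messages E d i ω :=
  measurable_pi_lambda _ fun i => measurable_messages (hE i i.2) (hd i i.2)

/-- The information of a node which sees the private signal `Y` and the messages `v i` of the
nodes `i ∈ I`. -/
abbrev observation (Y : Ω → S) (v : ℕ → Ω → Msg) (I : Set ℕ) : MeasurableSpace Ω :=
  MeasurableSpace.comap (fun ω => (Y ω, fun i : I => v i ω)) inferInstance

section Observation

variable {Y : Ω → S} {v : ℕ → Ω → Msg} {I J : Set ℕ}

lemma measurable_signal_observation : Measurable[observation Y v I] Y :=
  measurable_fst.comp (comap_measurable _)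

lemma measurable_message_observation (h : i ∈ I) : Measurable[observation Y v I] (v i) :=
  ((measurable_pi_apply (⟨i, h⟩ : I)).comp measurable_snd).comp
    (comap_measurable fun ω => (Y ω, fun i : I => v i ω))

lemma observation_le {𝓖 : MeasurableSpace Ω} (hY : Measurable[𝓖] Y)
    (hv : ∀ i ∈ I, Measurable[𝓖] (v i)) : observation Y v I ≤ 𝓖 :=
  (hY.prodMk (measurable_pi_lambda _ fun i => hv _ i.2)).comap_le

lemma observation_mono (h : I ⊆ J) : observation Y v I ≤ observation Y v J :=
  observation_le measurable_signal_observation fun _ hi => measurable_message_observation (h hi)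

end Observation

variable {mΩ : MeasurableSpace Ω} {P : Bool → Measure Ω} {μ : Bool → Measure S} {m : ℕ → ℕ}
  {t : ℕ → ℝ}

lemma decision_eq_true_iff (ω : Ω) : decision P μ X E m t k ω = true ↔
    ENNReal.ofReal (t k) < privateLR μ (X k ω) *
      obsLR P (fun ω (i : Set.Ico (k - m k) k) => messages E (decision P μ X E m t) i ω)
        (fun i => messages E (decision P μ X E m t) i ω) := by
  rw [decision, decide_eq_true_iff]
  rfl

lemma nonanticipating_decision : Nonanticipating X E (decision P μ X E m t) := by
  intro k
  induction k using Nat.strong_induction_on with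
  | _ k ih =>
    intro 𝓖 hX hE
    exact measurable_likelihoodRatioTest (hX k le_rfl)
      (measurable_messages_restrict (I := Set.Ico (k - m k) k) (fun i hi => hE i hi.2)
        fun i hi => ih i hi.2 𝓖 (fun j hj => hX j (hj.trans hi.2.le))
          fun j hj => hE j (hj.trans hi.2))
      decision_eq_true_iff

variable [∀ j, IsProbabilityMeasure (P j)] {p : Bool → ℝ} {q : ℕ → Bool → ℝ}
  {d : ℕ → Ω → Bool} {ε B : ℝ}

lemma div_one_sub_mem_Icc {ε q : ℝ} (hε : 0 < ε) (hq : q ≤ 1 - ε) :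
    ε / (1 - q) ∈ Set.Icc 0 1 :=
  have hεq : ε ≤ 1 - q := le_sub_comm.1 hq
  ⟨div_nonneg hε.le (hε.le.trans hεq), div_le_one_of_le₀ hεq (hε.le.trans hεq)⟩

lemma Nonanticipating.testRisk_acceptElse (hd : Nonanticipating X E d)
    (hN : ∀ h, IsErasureNetwork (P h) (μ h) q X E) (hε : 0 < ε) (hq : ∀ k j, q k j ≤ 1 - ε)
    {r k l : ℕ} {b : Bool → S → Bool} (hb : ∀ j, Measurable (b j)) {ψ : Ω → ℝ}
    (hψ : IsRandomizedTest (observation (X k) (messages E d) (Set.Ico r l)) ψ) :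
    testRisk P p (acceptElse (fun j => ε / (1 - q l j))
        (fun j => {ω | b j (X k ω) = true}.indicator 1) ψ (messages E d l)) =
      ε * errorProb P p (fun ω => b (d l ω) (X k ω)) + (1 - ε) * testRisk P p ψ := by
  have hXk := measurable_signal_allButChannel (X := X) (E := E) k l
  have hle := (hN true).allButChannel_le l
  have hdl := hd.measurable_allButChannel le_rfl (l := l)
  have hobs : observation (X k) (messages E d) (Set.Ico r l) ≤ allButChannel X E l :=
    observation_le hXk fun i hi => measurable_messages (measurable_channel_allButChannel hi.2.ne)
      (hd.measurable_allButChannel hi.2.le)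
  have hbd : Measurable fun ω => b (d l ω) (X k ω) :=
    (measurable_from_prod_countable_right (f := fun x : Bool × S => b x.1 x.2) hb).comp
      ((hdl.mono hle le_rfl).prodMk ((hN true).measurable_signal k))
  have haccept (h j : Bool) : ε / (1 - q l j) * (P h).real {ω | E l ω j = false} = ε := by
    rw [(hN h).measureReal_not_erased]
    exact div_mul_cancel₀ _ (by linarith [hq l j])
  rw [errorProb_eq_testRisk P p hbd]
  exact testRisk_mix P p fun h => integral_acceptElse hle ((hN h).measurable_channel l)
    ((hN h).indep_channel_allButChannel l) hdl (haccept h)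
    (fun j => .indicator_eq_true ((hb j).comp hXk)) (hψ.mono hobs)

theorem Nonanticipating.exists_randomizedTest_testRisk_le (hd : Nonanticipating X E d)
    (hN : ∀ h, IsErasureNetwork (P h) (μ h) q X E) (hε : 0 < ε) (hε₁ : ε ≤ 1)
    (hq : ∀ k j, q k j ≤ 1 - ε) (k r n : ℕ)
    (hB : ∀ l ∈ Set.Ico r (r + n), ∃ b : Bool → S → Bool, (∀ j, Measurable (b j)) ∧
      errorProb P p (fun ω => b (d l ω) (X k ω)) ≤ B) :
    ∃ φ, IsRandomizedTest (observation (X k) (messages E d) (Set.Ico r (r + n))) φ ∧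
      testRisk P p φ ≤ B + (p true - B) * (1 - ε) ^ n := by
  induction n with
  | zero => exact ⟨fun _ => 0, .zero _, by simp [testRisk]⟩
  | succ n ih =>
    obtain ⟨ψ, hψ, hψB⟩ := ih fun l hl => hB l ⟨hl.1, hl.2.trans (Nat.lt_succ_self _)⟩
    obtain ⟨b, hb, hbB⟩ := hB (r + n) ⟨by omega, by omega⟩
    have hmono : observation (X k) (messages E d) (Set.Ico r (r + n)) ≤
        observation (X k) (messages E d) (Set.Ico r (r + (n + 1))) :=
      observation_mono (Set.Ico_subset_Ico_right (by omega))
    refine ⟨_, .acceptElse (fun j => div_one_sub_mem_Icc hε (hq (r + n) j))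
      (fun j => .indicator_eq_true ((hb j).comp measurable_signal_observation)) (hψ.mono hmono)
      (measurable_message_observation (i := r + n) ⟨by omega, by omega⟩), ?_⟩
    calc _ = ε * errorProb P p (fun ω => b (d (r + n) ω) (X k ω)) + (1 - ε) * testRisk P p ψ :=
          hd.testRisk_acceptElse hN hε hq hb hψ
      _ ≤ ε * B + (1 - ε) * (B + (p true - B) * (1 - ε) ^ n) := by
          have := sub_nonneg.2 hε₁
          gcongr
      _ = B + (p true - B) * (1 - ε) ^ (n + 1) := by ring

variable [∀ j, IsProbabilityMeasure (μ j)]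

theorem errorProb_decision_le (hp : ∀ j, 0 < p j) (hμ : μ true ≪ μ false)
    (hN : ∀ h, IsErasureNetwork (P h) (μ h) q X E) (hε : 0 < ε) (hε₁ : ε ≤ 1)
    (hq : ∀ k j, q k j ≤ 1 - ε) {n : ℕ} (hnk : n ≤ k) (hnm : n ≤ m k)
    (hB : ∀ l ∈ Set.Ico (k - n) k, ∃ b : Bool → S → Bool, (∀ j, Measurable (b j)) ∧
      errorProb P p
        (fun ω => b (decision P μ X E m (fun _ => p false / p true) l ω) (X k ω)) ≤ B) :
    errorProb P p (decision P μ X E m (fun _ => p false / p true) k) ≤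
      B + (p true - B) * (1 - ε) ^ n := by
  set d := decision P μ X E m fun _ => p false / p true
  have hd : Nonanticipating X E d := nonanticipating_decision
  have hD : Measurable[allButNode X E k] fun ω (i : Set.Ico (k - m k) k) => messages E d i ω :=
    measurable_messages_restrict (I := Set.Ico (k - m k) k)
      (fun i hi => measurable_snd.comp (measurable_node_allButNode hi.2.ne))
      fun i hi => hd.measurable_allButNode hi.2
  have hle : allButNode X E k ≤ mΩ :=
    allButNode_le_allButChannel.trans ((hN true).allButChannel_le k)
  obtain ⟨φ, hφ, hφB⟩ := hd.exists_randomizedTest_testRisk_le hN hε hε₁ hq k (k - n) n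
    (by rwa [Nat.sub_add_cancel hnk])
  rw [Nat.sub_add_cancel hnk] at hφ
  refine le_trans ?_ hφB
  exact errorProb_le_testRisk_of_likelihoodRatioTest hμ hp ((hN true).measurable_signal k)
    (hD.mono hle le_rfl) (fun h => (hN h).map_signal k)
    (fun h => (hN h).indepFun_signal_of_measurable_allButNode hD)
    decision_eq_true_iff
    (hφ.mono (observation_mono (Set.Ico_subset_Ico_left (by omega))))

theorem exists_lt_eventually_errorProb_decision_le (hp : ∀ j, 0 < p j) (hμ : UnboundedLR μ)
    (hμ₁₀ : μ true ≪ μ false) (hm : Tendsto m atTop atTop)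
    (hN : ∀ h, IsErasureNetwork (P h) (μ h) q X E) (hε : 0 < ε) (hε₁ : ε ≤ 1)
    (hq : ∀ k j, q k j ≤ 1 - ε) {c : ℝ} (hc : 0 < c) :
    ∃ c' < c, ∃ c'' > c,
      (∀ᶠ k in atTop, errorProb P p (decision P μ X E m (fun _ => p false / p true) k) ≤ c'') →
      ∀ᶠ k in atTop, errorProb P p (decision P μ X E m (fun _ => p false / p true) k) ≤ c' := by
  set d := decision P μ X E m fun _ => p false / p true
  obtain ⟨γ, hγ, hrule⟩ := exists_rule_errorProb_le (P := P) hμ hμ₁₀ hp (half_pos hc)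
  obtain ⟨B, hBdef⟩ : ∃ B, B = max (c / 2) (c - γ / 2) := ⟨_, rfl⟩
  have hBc : B < c := hBdef ▸ max_lt (half_lt_self hc) (sub_lt_self _ (half_pos hγ))
  have hlim : Tendsto (fun n => B + (p true - B) * (1 - ε) ^ n) atTop (𝓝 B) := by
    simpa only [mul_zero, add_zero] using tendsto_const_nhds.add <| tendsto_const_nhds.mul <|
      tendsto_pow_atTop_nhds_zero_of_lt_one (sub_nonneg.2 hε₁) (sub_lt_self 1 hε)
  obtain ⟨c', hBc', hc'⟩ := exists_between hBc
  obtain ⟨n, hn⟩ := (hlim.eventually_le_const hBc').exists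
  refine ⟨c', hc', c + γ / 2, lt_add_of_pos_right _ (half_pos hγ), fun hev => ?_⟩
  obtain ⟨N, hN'⟩ := eventually_atTop.1 hev
  filter_upwards [hm.eventually_ge_atTop n, eventually_ge_atTop (N + n)] with k hmk hk
  refine (errorProb_decision_le hp hμ₁₀ hN hε hε₁ hq (by omega) hmk fun l hl => ?_).trans hn
  obtain ⟨b, hb, hbd⟩ := hrule (X k) (d l) ((hN true).measurable_signal k)
    (fun h => (hN h).map_signal k) fun h => ((hN h).indepFun_signal_of_measurable_allButNode
      (nonanticipating_decision.measurable_allButNode hl.2)).symm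
  refine ⟨b, hb, hbd.trans (hBdef ▸ max_le_max le_rfl ?_)⟩
  linarith [hN' l (by have := hl.1; omega)]

end Network

lemma tendsto_zero_of_eventually_le_improve {u : ℕ → ℝ} {C : ℝ} (h₀ : ∀ k, 0 ≤ u k)
    (hC : ∀ k, u k ≤ C)
    (H : ∀ c, 0 < c → ∃ c' < c, ∃ c'' > c, (∀ᶠ k in atTop, u k ≤ c'') →
      ∀ᶠ k in atTop, u k ≤ c') : Tendsto u atTop (𝓝 0) := by
  have hbdd : IsBoundedUnder (· ≤ ·) atTop u := isBoundedUnder_of ⟨C, hC⟩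
  have hcobdd : IsCoboundedUnder (· ≤ ·) atTop u :=
    (isBoundedUnder_of ⟨0, h₀⟩ : IsBoundedUnder (· ≥ ·) atTop u).isCoboundedUnder_flip
  have hsup : limsup u atTop ≤ 0 := by
    by_contra! hpos
    obtain ⟨c', hc', c'', hc'', himp⟩ := H _ hpos
    have : ∀ᶠ k in atTop, u k ≤ c'' :=
      (eventually_lt_of_limsup_lt hc'' hbdd).mono fun _ h => h.le
    exact hc'.not_ge (limsup_le_of_le hcobdd (himp this))
  exact tendsto_of_le_liminf_of_limsup_le
    (le_liminf_of_le hbdd.isCoboundedUnder_flip (.of_forall h₀)) hsup hbdd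
    (isBoundedUnder_of ⟨0, h₀⟩)

end ErasureLearning

theorem theorem2_general {Ω S : Type*} [MeasurableSpace Ω] [MeasurableSpace S]
    (p : Bool → ℝ) (hp_pos : ∀ j, 0 < p j)
    (μ : Bool → Measure S) [∀ j, IsProbabilityMeasure (μ j)] (hμ₁₀ : μ true ≪ μ false)
    (hμ : ErasureLearning.UnboundedLR μ) (m : ℕ → ℕ) (hm : Tendsto m atTop atTop)
    (q : ℕ → Bool → ℝ) (ε : ℝ) (hε : 0 < ε) (hq : ∀ k j, q k j ≤ 1 - ε)
    (P : Bool → Measure Ω) [∀ j, IsProbabilityMeasure (P j)]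
    (X : ℕ → Ω → S) (E : ℕ → Ω → Bool → Bool)
    (hN : ∀ h, ErasureLearning.IsErasureNetwork (P h) (μ h) q X E) :
    Tendsto (fun k => ErasureLearning.errorProb P p
      (ErasureLearning.decision P μ X E m (fun _ => p false / p true) k)) atTop (𝓝 0) := by
  have hε₁ : ε ≤ 1 := by
    have hq₀ : 0 ≤ q 0 true := (hN true).measureReal_erased 0 true ▸ measureReal_nonneg
    linarith [hq 0 true]
  exact ErasureLearning.tendsto_zero_of_eventually_le_improve
    (fun _ => ErasureLearning.errorProb_nonneg P (fun j => (hp_pos j).le) _)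
    (fun _ => ErasureLearning.errorProb_le_add P (fun j => (hp_pos j).le) _)
    fun _ => ErasureLearning.exists_lt_eventually_errorProb_decision_le hp_pos hμ hμ₁₀ hm hN
      hε hε₁ hq

theorem theorem2 {Ω S : Type*} [MeasurableSpace Ω] [MeasurableSpace S]
    -- prior probabilities of the two hypotheses
    (p : Bool → ℝ) (hp_pos : ∀ j, 0 < p j) (hp_sum : p false + p true = 1)
    -- laws of a private signal under the two hypotheses
    (μ : Bool → Measure S) [∀ j, IsProbabilityMeasure (μ j)]
    (hμ₀₁ : μ false ≪ μ true) (hμ₁₀ : μ true ≪ μ false)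
    (hμ : ErasureLearning.UnboundedLR μ)
    -- memory sizes
    (m : ℕ → ℕ) (hm : Tendsto m atTop atTop)
    -- `q k j` is the probability that the channel of node `k` erases the decision `j`
    (q : ℕ → Bool → ℝ) (ε : ℝ) (hε : 0 < ε) (hq : ∀ k j, q k j ≤ 1 - ε)
    -- the probability measures associated with the two hypotheses
    (P : Bool → Measure Ω) [∀ j, IsProbabilityMeasure (P j)]
    -- private signals and channels, all of them independent under each hypothesis
    (X : ℕ → Ω → S) (E : ℕ → Ω → Bool → Bool)
    (hX : ∀ k, Measurable (X k)) (hE : ∀ k, Measurable (E k))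
    (hXlaw : ∀ h k, (P h).map (X k) = μ h)
    (hElaw : ∀ h k j, (P h).real {ω | E k ω j = true} = q k j)
    (hXE : ∀ h k, IndepFun (X k) (E k) (P h))
    (hindep : ∀ h, iIndepFun (fun k ω => (X k ω, E k ω)) (P h)) :
    ∃ t : ℕ → ℝ, (∀ k, 0 < t k) ∧
      Tendsto
        (fun k => ErasureLearning.errorProb P p (ErasureLearning.decision P μ X E m t k))
        atTop (𝓝 0) :=
  ⟨fun _ => p false / p true, fun _ => div_pos (hp_pos false) (hp_pos true),
    theorem2_general p hp_pos μ hμ₁₀ hμ m hm q ε hε hq P X E fun h =>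
      ⟨hX, hE, hXlaw h, hElaw h, hXE h, hindep h⟩⟩
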